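/- Let $X$ be the complex Banach space $\ell^p$ with $1\le p<\infty$, or the complex Banach space $c_0$ of null sequences with the supremum norm, and let $(e_n)_{n\ge 1}$ be its canonical basis; put $e_0=0$. Let $(w_n)_{n\ge 1}$ be a sequence of non-zero complex numbers, and let $B_w:X\to X$ be a continuous linear operator with $B_we_n=w_ne_{n-1}$ for all $n\ge 1$ (the unilateral weighted shift with weights $w_n$). A vector $x\in X$ is called hypercyclic for $B_w$ if $\{B_w^nx: n\ge 1\}$ is dense in $X$; the operator $B_w$ is called hypercyclic if it has a hypercyclic vector; and a hypercyclic subspace for $B_w$ is an infinite-dimensional closed linear subspace of $X$ in which every non-zero vector is hypercyclic for $B_w$. Suppose that $B_w$ is hypercyclic. Then $B_w$ has a hypercyclic subspace if and only if \[\sup_{n\ge 1}\,\inf_{k\ge 1}\,\prod_{\nu=1}^n |w_{\nu+k}|\le 1,\] or equivalently if and only if \[\sup_{n\ge 1}\,\inf_{k\ge 1}\,\prod_{\nu=1}^n |w_{\nu+k}|<\infty.\] -/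

import Mathlib

open Filter Topology
open scoped ENNReal ZeroAtInfty

section Hypercyclicity

variable {X : Type*} [NormedAddCommGroup X] [NormedSpace ℂ X]

/-- `x` is a hypercyclic vector of the operator `T`: the set `{T ^ n x : n ≥ 1}` is dense. -/
def IsHypercyclicVector (T : X →L[ℂ] X) (x : X) : Prop :=
  Dense {y : X | ∃ n : ℕ, 1 ≤ n ∧ (T ^ n) x = y}

/-- The operator `T` is hypercyclic: it has a hypercyclic vector. -/
def IsHypercyclic (T : X →L[ℂ] X) : Prop :=
  ∃ x : X, IsHypercyclicVector T x

/-- The operator `T` has a hypercyclic subspace: an infinite-dimensional closed linear subspace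
in which every nonzero vector is hypercyclic for `T`. -/
def HasHypercyclicSubspace (T : X →L[ℂ] X) : Prop :=
  ∃ M : Submodule ℂ X, IsClosed (M : Set X) ∧ ¬ FiniteDimensional ℂ M ∧
    ∀ x ∈ M, x ≠ 0 → IsHypercyclicVector T x

/-- `T` is the unilateral weighted (backward) shift with weights `w 1, w 2, …` relative to
the vectors `e 1, e 2, …` (with `e 0 = 0`): `T e_n = w_n e_{n-1}` for all `n ≥ 1`.
The value `w 0` plays no role. When the linear span of the `e n` is dense, as for the canonical
bases below, the continuous operator `T` is uniquely determined by this. -/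
def IsWeightedShift (e : ℕ → X) (w : ℕ → ℂ) (T : X →L[ℂ] X) : Prop :=
  ∀ n : ℕ, 1 ≤ n → T (e n) = w n • e (n - 1)

end Hypercyclicity

/-- The canonical basis `e_1, e_2, …` of complex `ℓ^p`, with the convention `e_0 = 0`.
Sequences `(x_1, x_2, …)` are functions on `ℕ = {0, 1, …}` here, with `x_{i+1}` at position `i`;
so `e_{i+1}` is the sequence whose only nonzero entry is a `1` at position `i`. -/
noncomputable def lpBasis (p : ℝ≥0∞) : ℕ → lp (fun _ : ℕ => ℂ) p
  | 0 => 0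
  | i + 1 => lp.single p i 1

/-- The element of `c_0` whose only nonzero entry is a `1` at position `i`.
As `ℕ` is discrete, `C₀(ℕ, ℂ)` with its sup norm is the Banach space `c_0` of complex
null sequences. -/
noncomputable def c0Single (i : ℕ) : C₀(ℕ, ℂ) where
  toFun := Pi.single i 1
  continuous_toFun := continuous_of_discreteTopology
  zero_at_infty' := by
    rw [cocompact_eq_cofinite]
    refine tendsto_const_nhds.congr' ?_
    filter_upwards [(Set.finite_singleton i).compl_mem_cofinite] with j hj
    exact (Pi.single_eq_of_ne (M := fun _ : ℕ => ℂ) hj 1).symm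

/-- The canonical basis `e_1, e_2, …` of complex `c_0`, with the convention `e_0 = 0`; the
entry `x_{i+1}` of a sequence `(x_1, x_2, …)` is at position `i`. -/
noncomputable def c0Basis : ℕ → C₀(ℕ, ℂ)
  | 0 => 0
  | i + 1 => c0Single i

/-- `sup_{n ≥ 1} inf_{k ≥ 1} ∏_{ν = 1}^n |w_{ν + k}|`, as an element of `[0, ∞]`. -/
noncomputable def supInfProd (w : ℕ → ℂ) : ℝ≥0∞ :=
  ⨆ (n : ℕ) (_ : 1 ≤ n), ⨅ (k : ℕ) (_ : 1 ≤ k), ∏ ν ∈ Finset.Icc 1 n, ‖w (ν + k)‖ₑ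

/-! Write P_n(i) for `shiftProd w n i`. With positions counted from 0, coordinate i of B^n x has
modulus P_n(i)|x_{i+n}|, so everything depends on how products over windows of consecutive weights
grow. `ShiftBasis` collects what ℓ^p and c_0 share.

Necessity: if the supremum exceeds 1, some window length has all its products at least c > 1, so
P_N(i) ≥ C_N → ∞ uniformly in i and ‖B^N x‖ ≥ C_N ‖`tail N x`‖. By a gliding hump
(`exists_slowly_decaying_tail`), every infinite-dimensional closed subspace contains a nonzero x
with ‖`tail N x`‖ ≥ 1/C_N eventually. Its orbit finally stays outside the open unit ball.

Sufficiency: if the supremum is finite, `exists_shiftProd_le_two` yields positions r_t and times T_t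
such that B^{T_t} x → 0 for all x supported on the r_t. Hypercyclicity gives tiny z_t which
B^{T_{t+1}} sends to truncations of orbit points of a hypercyclic x₀. Adding K = ∑ x_{r(ι t)} z_t to
the identity keeps the subspace closed and infinite-dimensional, and B^{T_{t+1}}(x + Kx) is close to
x_{r(ι t)} B^{σ t} x₀, which is dense as soon as one coordinate of x is nonzero.

Since ≤ 1 implies < ∞, these two implications give both equivalences. -/

/-- A coordinate system on a space of sequences, whose norm is monotone in the moduli of the
coordinates and invariant under shifts, and whose finitely supported vectors are dense. -/
structure ShiftBasis (X : Type*) [NormedAddCommGroup X] [NormedSpace ℂ X] where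
  /-- the coordinates of a vector -/
  coord : ℕ → X →ₗ[ℂ] ℂ
  /-- the basis vectors -/
  single : ℕ → X
  coord_single : ∀ i j, coord i (single j) = if i = j then 1 else 0
  norm_single : ∀ i, ‖single i‖ = 1
  -- The two offsets permit comparing B^n x with a tail of x in either direction: (n, 0) for lower
  -- bounds, (0, n) for upper bounds.
  norm_le_of_shift : ∀ (m n : ℕ) (x y : X), (∀ i < m, coord i x = 0) →
    (∀ i, ‖coord (i + m) x‖ ≤ ‖coord (i + n) y‖) → ‖x‖ ≤ ‖y‖
  tendsto_sum : ∀ x, Tendsto (fun n => ∑ i ∈ Finset.range n, coord i x • single i) atTop (𝓝 x)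

/-- The modulus of the product of `n` consecutive weights governing `B ^ n` at coordinate `i`. -/
noncomputable def shiftProd (w : ℕ → ℂ) (n i : ℕ) : ℝ :=
  ∏ ν ∈ Finset.range n, ‖w (ν + i + 2)‖

namespace ShiftBasis

variable {X : Type*} [NormedAddCommGroup X] [NormedSpace ℂ X] (b : ShiftBasis X)

theorem norm_coord_le (i : ℕ) (x : X) : ‖b.coord i x‖ ≤ ‖x‖ := by
  have h : ‖b.coord i x • b.single i‖ ≤ ‖x‖ := by
    refine b.norm_le_of_shift 0 0 _ _ (by simp) fun j => ?_
    simp only [map_smul, b.coord_single, add_zero]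
    split_ifs with h <;> simp [h]
  simpa [norm_smul, b.norm_single] using h

/-- The coordinates as continuous functionals. -/
noncomputable def coordL (i : ℕ) : X →L[ℂ] ℂ :=
  (b.coord i).mkContinuous 1 fun x => by simpa using b.norm_coord_le i x

@[simp] theorem coordL_apply (i : ℕ) (x : X) : b.coordL i x = b.coord i x := rfl

theorem norm_coordL_le (i : ℕ) : ‖b.coordL i‖ ≤ 1 :=
  LinearMap.mkContinuous_norm_le _ zero_le_one _

theorem eq_zero_of_coord {x : X} (h : ∀ i, b.coord i x = 0) : x = 0 := by
  have := b.norm_le_of_shift 0 0 x 0 (by simp) (by simp [h])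
  simpa using this

theorem ext_coord {x y : X} (h : ∀ i, b.coord i x = b.coord i y) : x = y :=
  sub_eq_zero.1 <| b.eq_zero_of_coord fun i => by simp [h]

/-- Removal of the first `n` coordinates. -/
noncomputable def tail (n : ℕ) : X →L[ℂ] X :=
  ContinuousLinearMap.id ℂ X - ∑ i ∈ Finset.range n, (b.coordL i).smulRight (b.single i)

theorem tail_apply (n : ℕ) (x : X) :
    b.tail n x = x - ∑ i ∈ Finset.range n, b.coord i x • b.single i := by
  simp [tail]

theorem coord_tail (n i : ℕ) (x : X) :
    b.coord i (b.tail n x) = if i < n then 0 else b.coord i x := by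
  simp only [tail_apply, map_sub, map_sum, map_smul, b.coord_single, smul_eq_mul, mul_ite,
    mul_one, mul_zero, Finset.sum_ite_eq, Finset.mem_range]
  split_ifs <;> simp

theorem tendsto_tail (x : X) : Tendsto (fun n => b.tail n x) atTop (𝓝 0) := by
  simpa [tail_apply] using (tendsto_const_nhds (x := x)).sub (b.tendsto_sum x)

theorem norm_tail_le_tail {m n : ℕ} (h : m ≤ n) (x : X) : ‖b.tail n x‖ ≤ ‖b.tail m x‖ := by
  refine b.norm_le_of_shift 0 0 _ _ (by simp) fun i => ?_
  simp only [coord_tail, add_zero]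
  split_ifs with h1 h2 h2
  · simp
  · simp
  · omega
  · rfl

theorem norm_tail_le (n : ℕ) (x : X) : ‖b.tail n x‖ ≤ ‖x‖ := by
  simpa [tail_apply] using b.norm_tail_le_tail (Nat.zero_le n) x

theorem tail_eq_self {n : ℕ} {x : X} (h : ∀ i < n, b.coord i x = 0) : b.tail n x = x :=
  b.ext_coord fun i => by rw [coord_tail]; split_ifs with hi <;> simp [h, hi]

end ShiftBasis

/-! ### Window products and the coordinates of powers of the shift -/

section Prod

variable {w : ℕ → ℂ}

theorem shiftProd_nonneg (n i : ℕ) : 0 ≤ shiftProd w n i :=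
  Finset.prod_nonneg fun _ _ => norm_nonneg _

theorem shiftProd_pos (hw : ∀ n : ℕ, 1 ≤ n → w n ≠ 0) (n i : ℕ) : 0 < shiftProd w n i :=
  Finset.prod_pos fun _ _ => norm_pos_iff.2 (hw _ (by omega))

theorem shiftProd_add (m n i : ℕ) :
    shiftProd w (m + n) i = shiftProd w m i * shiftProd w n (m + i) := by
  simp only [shiftProd, Finset.prod_range_add]
  congr 1
  exact Finset.prod_congr rfl fun ν _ => by congr 2; omega

@[simp] theorem shiftProd_zero (i : ℕ) : shiftProd w 0 i = 1 := by simp [shiftProd]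

theorem shiftProd_le_pow {W : ℝ} (hW : ∀ i, ‖w (i + 2)‖ ≤ W) (n i : ℕ) :
    shiftProd w n i ≤ W ^ n := by
  simpa [shiftProd] using Finset.prod_le_prod (s := Finset.range n) (g := fun _ => W)
    (fun ν _ => norm_nonneg (w (ν + i + 2))) fun ν _ => hW (ν + i)

/-- Position i carries e_{i+1}, so the window met there starts at w_{i+2}; this is k = i + 1 in the
supremum. -/
theorem enorm_prod_eq_shiftProd (n i : ℕ) :
    ∏ ν ∈ Finset.Icc 1 n, ‖w (ν + (i + 1))‖ₑ = ENNReal.ofReal (shiftProd w n i) := by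
  rw [shiftProd, ENNReal.ofReal_prod_of_nonneg fun _ _ => norm_nonneg _,
    ← Finset.Ico_succ_right_eq_Icc, Finset.prod_Ico_eq_prod_range]
  refine Finset.prod_congr (by simp) fun ν _ => ?_
  rw [ofReal_norm]
  congr 2
  omega

end Prod

section Shift

variable {X : Type*} [NormedAddCommGroup X] [NormedSpace ℂ X] (b : ShiftBasis X)
  {w : ℕ → ℂ} {B : X →L[ℂ] X}

namespace ShiftBasis

theorem coord_shift_of_single (h0 : B (b.single 0) = 0)
    (hB : ∀ i, B (b.single (i + 1)) = w (i + 2) • b.single i) (i : ℕ) (x : X) :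
    b.coord i (B x) = w (i + 2) * b.coord (i + 1) x := by
  have h1 := ((b.coordL i).continuous.tendsto _).comp
    ((B.continuous.tendsto _).comp (b.tendsto_sum x))
  refine tendsto_nhds_unique h1 (tendsto_const_nhds.congr' ?_)
  filter_upwards [eventually_gt_atTop (i + 1)] with n hn
  obtain ⟨n, rfl⟩ : ∃ m, n = m + 1 := ⟨n - 1, by omega⟩
  have hi : i < n := by omega
  simp [Finset.sum_range_succ', h0, hB, b.coord_single, hi, mul_comm]

theorem coord_pow (hB : ∀ i x, b.coord i (B x) = w (i + 2) * b.coord (i + 1) x)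
    (n i : ℕ) (x : X) :
    b.coord i ((B ^ n) x) = (∏ ν ∈ Finset.range n, w (ν + i + 2)) * b.coord (i + n) x := by
  induction n generalizing i with
  | zero => simp
  | succ n ih =>
    rw [pow_succ', mul_apply_eq_comp, hB, ih,
      Finset.prod_range_succ', mul_comm (∏ ν ∈ Finset.range n, w (ν + 1 + i + 2)), mul_assoc]
    simp only [zero_add, add_right_comm _ 1 i, ← add_assoc]
    rw [add_right_comm i 1 n]

theorem norm_coord_pow (hB : ∀ i x, b.coord i (B x) = w (i + 2) * b.coord (i + 1) x)
    (n i : ℕ) (x : X) :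
    ‖b.coord i ((B ^ n) x)‖ = shiftProd w n i * ‖b.coord (i + n) x‖ := by
  rw [b.coord_pow hB, norm_mul, norm_prod, shiftProd]

theorem norm_weight_le (hB : ∀ i x, b.coord i (B x) = w (i + 2) * b.coord (i + 1) x) (i : ℕ) :
    ‖w (i + 2)‖ ≤ ‖B‖ := by
  have h := (b.norm_coord_le i (B (b.single (i + 1)))).trans (B.le_opNorm _)
  simpa [hB, b.coord_single, b.norm_single] using h

end ShiftBasis

end Shift

/-! ### Growth of window products -/

section Prod

variable {w : ℕ → ℂ}

/-- Strip blocks from the right end of the window: each has length at most m and product above 2, so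
at least q of them are met. The last block may overshoot the left end, which costs at most W^m. -/
theorem two_pow_le_shiftProd_mul {W : ℝ} (hW1 : 1 ≤ W) (hW : ∀ i, ‖w (i + 2)‖ ≤ W) {m R : ℕ}
    (h : ∀ i, R ≤ i → ∃ j ≤ m, 2 < shiftProd w j (i + m - j)) (n : ℕ) :
    ∀ i q : ℕ, R + m ≤ i → q * m ≤ n → 2 ^ q ≤ shiftProd w n i * W ^ m := by
  induction n using Nat.strong_induction_on with
  | _ n ih =>
    intro i q hi hq
    obtain ⟨j, hjm, hj⟩ := h (i + n - m) (by omega)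
    rw [show i + n - m + m - j = i + n - j by omega] at hj
    have hj0 : j ≠ 0 := by rintro rfl; norm_num at hj
    have hWm : 0 ≤ W ^ m := by positivity
    rcases le_or_gt j n with hjn | hjn
    · have e : shiftProd w n i = shiftProd w (n - j) i * shiftProd w j (i + n - j) := by
        have := shiftProd_add (w := w) (n - j) j i
        rwa [show n - j + j = n by omega, show n - j + i = i + n - j by omega] at this
      obtain ⟨q', hq', hqq⟩ : ∃ q', q' * m ≤ n - j ∧ (2 : ℝ) ^ q ≤ 2 ^ q' * 2 := by
        rcases q with _ | q
        · exact ⟨0, by simp, by norm_num⟩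
        · refine ⟨q, ?_, by rw [pow_succ]⟩
          rw [add_mul] at hq
          omega
      calc (2 : ℝ) ^ q ≤ 2 ^ q' * 2 := hqq
        _ ≤ (shiftProd w (n - j) i * W ^ m) * shiftProd w j (i + n - j) :=
          mul_le_mul (ih (n - j) (by omega) i q' hi hq') hj.le (by norm_num)
            (mul_nonneg (shiftProd_nonneg _ _) hWm)
        _ = _ := by rw [e]; ring
    · obtain rfl : q = 0 := by
        by_contra hq0
        have := Nat.le_mul_of_pos_left m (Nat.pos_of_ne_zero hq0)
        omega
      have e : shiftProd w j (i + n - j) = shiftProd w (j - n) (i + n - j) * shiftProd w n i := by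
        have := shiftProd_add (w := w) (j - n) n (i + n - j)
        rwa [show j - n + n = j by omega, show j - n + (i + n - j) = i by omega] at this
      have h1 : shiftProd w (j - n) (i + n - j) ≤ W ^ m :=
        (shiftProd_le_pow hW _ _).trans (pow_le_pow_right₀ hW1 (by omega))
      have h2 := mul_le_mul_of_nonneg_right h1 (shiftProd_nonneg (w := w) n i)
      rw [pow_zero]
      linarith

/-- If the products of `n` consecutive weights do not grow uniformly, then arbitrarily far out
all products of at most `m` weights ending at the same position are bounded by `2`. -/
theorem exists_shiftProd_le_two (hw : ∀ n : ℕ, 1 ≤ n → w n ≠ 0) {W : ℝ} (hW1 : 1 ≤ W)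
    (hW : ∀ i, ‖w (i + 2)‖ ≤ W) {C : ℝ} (hC : ∀ n, 1 ≤ n → ∃ i, shiftProd w n i ≤ C) (m R : ℕ) :
    ∃ i, R ≤ i ∧ ∀ j ≤ m, shiftProd w j (i + m - j) ≤ 2 := by
  by_contra! h
  have key := two_pow_le_shiftProd_mul hW1 hW h
  have hm : 0 < m := by
    rcases Nat.eq_zero_or_pos m with rfl | hm
    · obtain ⟨j, hj, hj'⟩ := h R le_rfl
      obtain rfl : j = 0 := by omega
      norm_num at hj'
    · exact hm
  set K := R + m with hK
  -- The growth estimate `key` needs a start at K or later. A window starting earlier is cut at K;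
  -- its initial piece is one of finitely many positive products.
  obtain ⟨δ, hδ, hδ'⟩ : ∃ δ : ℝ, 0 < δ ∧ ∀ i ≤ K, δ ≤ shiftProd w (K - i) i := by
    obtain ⟨i₀, -, hi₀⟩ := Finset.exists_min_image (Finset.range (K + 1))
      (fun i => shiftProd w (K - i) i) ⟨0, by simp⟩
    exact ⟨_, shiftProd_pos hw (K - i₀) i₀, fun i hi => hi₀ i (by simp; omega)⟩
  have hWm : 0 < W ^ m := by positivity
  obtain ⟨q, hq⟩ := pow_unbounded_of_one_lt (max 1 (max (C * W ^ m) (C * W ^ m / δ)))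
    (one_lt_two (α := ℝ))
  obtain ⟨i, hi⟩ := hC (K + q * m) (by omega)
  rcases le_or_gt K i with hKi | hKi
  · have h1 := key (K + q * m) i q hKi (by omega)
    have h2 := mul_le_mul_of_nonneg_right hi hWm.le
    have h3 := (le_max_left (C * W ^ m) (C * W ^ m / δ)).trans (le_max_right 1 _)
    linarith
  · have h1 := key (q * m + i) K q le_rfl (by omega)
    have e := shiftProd_add (w := w) (K - i) (q * m + i) i
    rw [show K - i + (q * m + i) = K + q * m by omega, show K - i + i = K by omega] at e
    have h2 : δ * 2 ^ q ≤ C * W ^ m := by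
      calc δ * 2 ^ q ≤ shiftProd w (K - i) i * (shiftProd w (q * m + i) K * W ^ m) :=
            mul_le_mul (hδ' i hKi.le) h1 (by positivity) (shiftProd_nonneg _ _)
        _ = shiftProd w (K + q * m) i * W ^ m := by rw [e]; ring
        _ ≤ _ := mul_le_mul_of_nonneg_right hi hWm.le
    have h3 := (le_max_right (C * W ^ m) (C * W ^ m / δ)).trans (le_max_right 1 _)
    have h4 : C * W ^ m / δ < 2 ^ q := by linarith
    rw [div_lt_iff₀ hδ] at h4
    linarith

/-- If all products of `n` consecutive weights exceed some `c > 1`, then the products of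
`N` consecutive weights tend to infinity uniformly. -/
theorem exists_tendsto_le_shiftProd {W : ℝ} (hW1 : 1 ≤ W)
    (hW : ∀ i, ‖w (i + 2)‖ ≤ W) {n : ℕ} (hn : 1 ≤ n) {c : ℝ} (hc : 1 < c)
    (h : ∀ i, c ≤ shiftProd w n i) :
    ∃ C : ℕ → ℝ, Tendsto C atTop atTop ∧ ∀ N i, C N ≤ shiftProd w N i := by
  have hpow : ∀ q i, c ^ q ≤ shiftProd w (q * n) i := by
    intro q
    induction q with
    | zero => simp
    | succ q ih =>
      intro i
      rw [add_mul, one_mul, shiftProd_add, pow_succ]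
      exact mul_le_mul (ih i) (h _) (by linarith) (shiftProd_nonneg _ _)
  have hWn : 0 < W ^ n := by positivity
  -- Extending a window of length N to the next multiple of n multiplies its product by at most W^n.
  refine ⟨fun N => c ^ (N / n) / W ^ n, ?_, fun N i => ?_⟩
  · exact ((tendsto_pow_atTop_atTop_of_one_lt hc).comp
      (Nat.tendsto_div_const_atTop (by omega))).atTop_div_const hWn
  · rw [div_le_iff₀ hWn]
    have hlt : N < (N / n + 1) * n := by
      rw [add_mul, one_mul]
      have := Nat.div_add_mod N n
      have := Nat.mod_lt N hn
      rw [mul_comm n] at *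
      omega
    have hle : (N / n) * n ≤ N := Nat.div_mul_le_self N n
    have e := shiftProd_add (w := w) N ((N / n + 1) * n - N) i
    rw [show N + ((N / n + 1) * n - N) = (N / n + 1) * n by omega] at e
    have h1 := hpow (N / n + 1) i
    have h2 : shiftProd w ((N / n + 1) * n - N) (N + i) ≤ W ^ n :=
      (shiftProd_le_pow hW _ _).trans (pow_le_pow_right₀ hW1 (by rw [add_mul, one_mul]; omega))
    have h3 := mul_le_mul_of_nonneg_left h2 (shiftProd_nonneg (w := w) N i)
    have h4 : c ^ (N / n) ≤ c ^ (N / n + 1) := pow_le_pow_right₀ hc.le (by omega)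
    linarith

theorem supInfProd_eq : supInfProd w =
    ⨆ (n : ℕ) (_ : 1 ≤ n), ⨅ i : ℕ, ENNReal.ofReal (shiftProd w n i) := by
  unfold supInfProd
  refine iSup_congr fun n => iSup_congr fun hn => le_antisymm (le_iInf fun i => ?_) ?_
  · exact (iInf₂_le (i + 1) (by omega)).trans (enorm_prod_eq_shiftProd n i).le
  · refine le_iInf₂ fun k hk => ?_
    obtain ⟨i, rfl⟩ : ∃ i, k = i + 1 := ⟨k - 1, by omega⟩
    exact (iInf_le _ i).trans (enorm_prod_eq_shiftProd n i).ge

theorem exists_shiftProd_le_of_supInfProd_lt_top (h : supInfProd w < ∞) :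
    ∃ C, ∀ n, 1 ≤ n → ∃ i, shiftProd w n i ≤ C := by
  refine ⟨(supInfProd w + 1).toReal, fun n hn => ?_⟩
  have h1 : ⨅ i : ℕ, ENNReal.ofReal (shiftProd w n i) < supInfProd w + 1 := by
    refine lt_of_le_of_lt ?_ (ENNReal.lt_add_right h.ne one_ne_zero)
    rw [supInfProd_eq]
    exact le_iSup₂ (f := fun n (_ : 1 ≤ n) => ⨅ i : ℕ, ENNReal.ofReal (shiftProd w n i)) n hn
  obtain ⟨i, hi⟩ := iInf_lt_iff.1 h1
  exact ⟨i, (ENNReal.ofReal_le_iff_le_toReal (by simp [h.ne])).1 hi.le⟩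

theorem exists_le_shiftProd_of_not_supInfProd_le_one (h : ¬ supInfProd w ≤ 1) :
    ∃ n, 1 ≤ n ∧ ∃ c : ℝ, 1 < c ∧ ∀ i, c ≤ shiftProd w n i := by
  rw [not_le, supInfProd_eq] at h
  obtain ⟨n, h⟩ := lt_iSup_iff.1 h
  obtain ⟨hn, h⟩ := lt_iSup_iff.1 h
  have htop : ⨅ i : ℕ, ENNReal.ofReal (shiftProd w n i) ≠ ∞ :=
    ((iInf_le (fun i => ENNReal.ofReal (shiftProd w n i)) 0).trans_lt ENNReal.ofReal_lt_top).ne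
  refine ⟨n, hn, (⨅ i : ℕ, ENNReal.ofReal (shiftProd w n i)).toReal, ?_, fun i => ?_⟩
  · simpa using (ENNReal.toReal_lt_toReal ENNReal.one_ne_top htop).2 h
  · exact ENNReal.toReal_le_of_le_ofReal (shiftProd_nonneg _ _) (iInf_le _ i)

end Prod

/-! ### Small preimages under powers of a hypercyclic shift -/

section Preimage

variable {X : Type*} [NormedAddCommGroup X] [NormedSpace ℂ X] (b : ShiftBasis X)
  {w : ℕ → ℂ} {B : X →L[ℂ] X}

namespace ShiftBasis

/-- The orbit of a hypercyclic x comes within 1 of (|A|‖x‖ + 1)e_1, whereas the first coordinate of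
B^n x is at most P_n(0)‖x‖. -/
theorem exists_lt_shiftProd_zero (hB : ∀ i x, b.coord i (B x) = w (i + 2) * b.coord (i + 1) x)
    (hyp : IsHypercyclic B) (A : ℝ) : ∃ n, A < shiftProd w n 0 := by
  obtain ⟨x, hx⟩ := hyp
  set c : ℝ := |A| * ‖x‖ + 1 with hc
  have hc0 : 0 ≤ c := by positivity
  obtain ⟨-, ⟨n, -, rfl⟩, hn⟩ := hx.exists_dist_lt ((c : ℂ) • b.single 0) one_pos
  refine ⟨n, ?_⟩
  have h1 := b.norm_coord_le 0 ((c : ℂ) • b.single 0 - (B ^ n) x)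
  rw [dist_eq_norm] at hn
  rw [map_sub, map_smul, b.coord_single] at h1
  simp only [if_true, smul_eq_mul, mul_one] at h1
  have h2 : c ≤ ‖(c : ℂ) - b.coord 0 ((B ^ n) x)‖ + ‖b.coord 0 ((B ^ n) x)‖ := by
    have := norm_add_le ((c : ℂ) - b.coord 0 ((B ^ n) x)) (b.coord 0 ((B ^ n) x))
    rwa [sub_add_cancel, Complex.norm_real, Real.norm_of_nonneg hc0] at this
  rw [b.norm_coord_pow hB] at h2
  have h3 := mul_le_mul_of_nonneg_left (b.norm_coord_le (0 + n) x)
    (shiftProd_nonneg (w := w) n 0)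
  by_contra! h
  have h4 := mul_le_mul_of_nonneg_right (h.trans (le_abs_self A)) (norm_nonneg x)
  linarith

/-- A long window from 0 with huge product contains, for each k < D, the window of length n - D from
k; the D discarded weights cost at most W^D. -/
theorem exists_forall_lt_shiftProd
    (hB : ∀ i x, b.coord i (B x) = w (i + 2) * b.coord (i + 1) x)
    (hyp : IsHypercyclic B) (A : ℝ) (D n₀ : ℕ) :
    ∃ N, n₀ ≤ N ∧ ∀ k < D, A < shiftProd w N k := by
  set W : ℝ := max 1 ‖B‖
  have hW1 : 1 ≤ W := le_max_left _ _
  have hW : ∀ i, ‖w (i + 2)‖ ≤ W := fun i => (b.norm_weight_le hB i).trans (le_max_right _ _)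
  -- The second entry of the maximum forces n ≥ n₀ + D, since P_n(0) ≤ W^n.
  obtain ⟨n, hn⟩ := b.exists_lt_shiftProd_zero hB hyp (max (A * W ^ D) (W ^ (n₀ + D)))
  have hle : n₀ + D ≤ n := by
    by_contra! h
    have h1 := (shiftProd_le_pow hW n 0).trans (pow_le_pow_right₀ hW1 h.le)
    exact absurd ((le_max_right _ _).trans_lt hn) (not_lt.2 h1)
  refine ⟨n - D, by omega, fun k hk => ?_⟩
  have h1 := (le_max_left _ _).trans_lt hn
  rw [show n = k + ((n - D) + (D - k)) by omega, shiftProd_add, shiftProd_add, add_zero] at h1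
  have h2 : shiftProd w k 0 * (shiftProd w (n - D) k * shiftProd w (D - k) (n - D + k)) ≤
      W ^ k * (shiftProd w (n - D) k * W ^ (D - k)) :=
    mul_le_mul (shiftProd_le_pow hW _ _)
      (mul_le_mul_of_nonneg_left (shiftProd_le_pow hW _ _) (shiftProd_nonneg _ _))
      (mul_nonneg (shiftProd_nonneg _ _) (shiftProd_nonneg _ _)) (by positivity)
  have e : W ^ D = W ^ k * W ^ (D - k) := by rw [← pow_add]; congr 1; omega
  refine lt_of_mul_lt_mul_right (a := W ^ D) ?_ (by positivity)
  calc A * W ^ D < _ := h1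
    _ ≤ _ := h2
    _ = _ := by rw [e]; ring

/-- Truncations have small finitely supported preimages under large powers of a hypercyclic
weighted shift. -/
theorem exists_small_preimage (hw : ∀ n : ℕ, 1 ≤ n → w n ≠ 0)
    (hB : ∀ i x, b.coord i (B x) = w (i + 2) * b.coord (i + 1) x)
    (hyp : IsHypercyclic B) (y : X) {ε : ℝ} (hε : 0 < ε) (D n₀ : ℕ) :
    ∃ N, n₀ ≤ N ∧ ∃ z : X, ‖z‖ ≤ ε ∧ (B ^ N) z = y - b.tail D y ∧
      ∀ n, N + D ≤ n → (B ^ n) z = 0 := by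
  -- With this threshold each of the D terms of z has norm at most ε / D.
  obtain ⟨N, hN, hA⟩ := b.exists_forall_lt_shiftProd hB hyp (D * ‖y‖ / ε) D n₀
  set z : X := ∑ k ∈ Finset.range D,
    (b.coord k y / ∏ ν ∈ Finset.range N, w (ν + k + 2)) • b.single (k + N) with hz
  have hcz : ∀ i, b.coord i z = ∑ k ∈ Finset.range D,
      if i = k + N then b.coord k y / ∏ ν ∈ Finset.range N, w (ν + k + 2) else 0 := by
    intro i
    simp [hz, b.coord_single]
  refine ⟨N, hN, z, ?_, ?_, ?_⟩
  · have : ∀ k ∈ Finset.range D,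
        ‖(b.coord k y / ∏ ν ∈ Finset.range N, w (ν + k + 2)) • b.single (k + N)‖ ≤ ε / D := by
      intro k hk
      have hD : (0 : ℝ) < D := by
        have := Finset.mem_range.1 hk
        exact_mod_cast (by omega : 0 < D)
      rw [norm_smul, b.norm_single, mul_one, norm_div, norm_prod]
      change _ / shiftProd w N k ≤ _
      have hp := shiftProd_pos hw N k
      have h1 := hA k (Finset.mem_range.1 hk)
      rw [div_lt_iff₀ hε] at h1
      rw [div_le_div_iff₀ hp hD]
      have := mul_le_mul_of_nonneg_right (b.norm_coord_le k y) hD.le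
      linarith
    refine (norm_sum_le_of_le _ this).trans ?_
    rw [Finset.sum_const, Finset.card_range, nsmul_eq_mul]
    rcases Nat.eq_zero_or_pos D with rfl | hD
    · simpa using hε.le
    · rw [mul_div_cancel₀]
      exact_mod_cast hD.ne'
  · refine b.ext_coord fun i => ?_
    rw [b.coord_pow hB, hcz, map_sub, b.coord_tail]
    simp only [add_left_inj, Finset.sum_ite_eq, Finset.mem_range]
    have hne : ∏ ν ∈ Finset.range N, w (ν + i + 2) ≠ 0 :=
      Finset.prod_ne_zero_iff.2 fun ν _ => hw _ (by omega)
    split_ifs with h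
    · rw [mul_div_cancel₀ _ hne, sub_zero]
    · simp
  · intro n hn
    refine b.eq_zero_of_coord fun i => ?_
    rw [b.coord_pow hB, hcz, Finset.sum_eq_zero, mul_zero]
    intro k hk
    rw [if_neg]
    have := Finset.mem_range.1 hk
    omega

end ShiftBasis

end Preimage

/-! ### Necessity: slowly decaying tails -/

namespace ShiftBasis

variable {X : Type*} [NormedAddCommGroup X] [NormedSpace ℂ X] (b : ShiftBasis X)
  {w : ℕ → ℂ} {B : X →L[ℂ] X}

theorem exists_norm_eq_one_of_not_finiteDimensional {M : Submodule ℂ X}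
    (hM : ¬ FiniteDimensional ℂ M) (L : ℕ) :
    ∃ x ∈ M, ‖x‖ = 1 ∧ ∀ i < L, b.coord i x = 0 := by
  obtain ⟨x, hxM, hx0, hx⟩ : ∃ x ∈ M, x ≠ 0 ∧ ∀ i < L, b.coord i x = 0 := by
    by_contra! h
    let f : M →ₗ[ℂ] (Fin L → ℂ) := (LinearMap.pi fun i : Fin L => b.coord i) ∘ₗ M.subtype
    refine hM (FiniteDimensional.of_injective f ?_)
    rw [← LinearMap.ker_eq_bot, LinearMap.ker_eq_bot']
    intro x hx
    by_contra hne
    obtain ⟨i, hi, hi'⟩ := h x x.2 (by simpa using hne)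
    exact hi' (congrFun hx ⟨i, hi⟩)
  refine ⟨((‖x‖⁻¹ : ℝ) : ℂ) • x, M.smul_mem _ hxM, ?_, fun i hi => by simp [hx i hi]⟩
  rw [norm_smul, Complex.norm_real, norm_inv, norm_norm, inv_mul_cancel₀ (norm_ne_zero_iff.2 hx0)]

/-- An infinite-dimensional closed subspace contains vectors whose tails decay as slowly as
one wishes. -/
theorem exists_slowly_decaying_tail [CompleteSpace X] {M : Submodule ℂ X}
    (hMc : IsClosed (M : Set X)) (hM : ¬ FiniteDimensional ℂ M) {ε : ℕ → ℝ}
    (hε : Tendsto ε atTop (𝓝 0)) :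
    ∃ x ∈ M, x ≠ 0 ∧ ∀ᶠ N in atTop, ε N ≤ ‖b.tail N x‖ := by
  choose u huM hu1 hu0 using b.exists_norm_eq_one_of_not_finiteDimensional hM
  -- Beyond L' the earlier humps are negligible and ε is already below the size that x will keep
  -- there.
  have step : ∀ j L : ℕ, ∃ L', L < L' ∧ (∀ l ≤ L, ‖b.tail L' (u l)‖ ≤ (1 / 4) ^ (j + 2)) ∧
      ∀ N, L' ≤ N → ε N ≤ (1 / 4) ^ (j + 3) := by
    intro j L
    have h1 : ∀ᶠ N in atTop, ∀ l ∈ Finset.range (L + 1),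
        ‖b.tail N (u l)‖ ≤ (1 / 4) ^ (j + 2) := by
      rw [Finset.eventually_all]
      intro l _
      have := (b.tendsto_tail (u l)).norm
      rw [norm_zero] at this
      exact this.eventually_le_const (by positivity)
    have h2 : ∀ᶠ N in atTop, ε N ≤ (1 / 4) ^ (j + 3) := hε.eventually_le_const (by positivity)
    obtain ⟨L', h1, h2, h3⟩ := (h1.and ((eventually_forall_ge_atTop.2 h2).and
      (eventually_gt_atTop L))).exists
    exact ⟨L', h3, fun l hl => h1 l (by simp; omega), h2⟩
  choose F hF1 hF2 hF3 using step
  let L : ℕ → ℕ := fun n => Nat.rec 0 (fun j l => F j l) n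
  have hL : ∀ j, L (j + 1) = F j (L j) := fun _ => rfl
  have hmono : StrictMono L := strictMono_nat_of_lt_succ fun j => by rw [hL]; exact hF1 _ _
  have hgeo : Summable fun i : ℕ => (1 / 4 : ℝ) ^ i :=
    summable_geometric_of_lt_one (by norm_num) (by norm_num)
  have hgeo' : ∑' i : ℕ, (1 / 4 : ℝ) ^ i = 4 / 3 := by
    rw [tsum_geometric_of_lt_one (by norm_num) (by norm_num)]; norm_num
  have hnorm : ∀ i, ‖((1 / 4 : ℂ) ^ i) • u (L i)‖ = (1 / 4 : ℝ) ^ i := by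
    intro i
    rw [norm_smul, hu1]
    simp
  have hsum : Summable fun i => ((1 / 4 : ℂ) ^ i) • u (L i) :=
    Summable.of_norm (by simpa only [hnorm] using hgeo)
  set x : X := ∑' i, ((1 / 4 : ℂ) ^ i) • u (L i) with hx
  -- At L (J + 1) the term of index J + 1 survives whole, with norm (1/4)^(J+1). The earlier and the
  -- later terms each remove at most a third of that, and the remaining third exceeds a quarter.
  have hlow : ∀ J, (1 / 4 : ℝ) ^ (J + 2) ≤ ‖b.tail (L (J + 1)) x‖ := by
    intro J
    have hs := hsum.map (b.tail (L (J + 1))) (b.tail (L (J + 1))).continuous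
    have e : b.tail (L (J + 1)) x = _ := (b.tail (L (J + 1))).map_tsum hsum
    have e2 := hs.sum_add_tsum_nat_add (J + 2)
    rw [Finset.sum_range_succ] at e2
    simp only [Function.comp_def] at e2
    rw [← e] at e2
    set S₁ := ∑ i ∈ Finset.range (J + 1), b.tail (L (J + 1)) ((1 / 4 : ℂ) ^ i • u (L i))
    set S₂ := ∑' i, b.tail (L (J + 1)) ((1 / 4 : ℂ) ^ (i + (J + 2)) • u (L (i + (J + 2))))
    have h1 : ‖S₁‖ ≤ (1 / 3) * (1 / 4) ^ (J + 1) := by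
      calc ‖S₁‖ ≤ ∑ i ∈ Finset.range (J + 1), (1 / 4 : ℝ) ^ i * (1 / 4) ^ (J + 2) := by
            refine norm_sum_le_of_le _ fun i hi => ?_
            rw [map_smul, norm_smul]
            have : ‖(1 / 4 : ℂ) ^ i‖ = (1 / 4 : ℝ) ^ i := by simp
            rw [this, hL]
            exact mul_le_mul_of_nonneg_left
              (hF2 J (L J) (L i) (hmono.monotone (by simpa [Nat.lt_succ_iff] using hi)))
              (by positivity)
        _ ≤ 4 / 3 * (1 / 4) ^ (J + 2) := by
            rw [← Finset.sum_mul, ← hgeo']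
            exact mul_le_mul_of_nonneg_right
              (hgeo.sum_le_tsum _ fun _ _ => by positivity) (by positivity)
        _ = _ := by ring
    have h2 : ‖S₂‖ ≤ (1 / 3) * (1 / 4) ^ (J + 1) := by
      have hs2 : HasSum (fun i : ℕ => (1 / 4 : ℝ) ^ i * (1 / 4) ^ (J + 2))
          (4 / 3 * (1 / 4) ^ (J + 2)) := (hgeo' ▸ hgeo.hasSum).mul_right _
      calc ‖S₂‖ ≤ 4 / 3 * (1 / 4) ^ (J + 2) := by
            refine tsum_of_norm_bounded hs2 fun i => (b.norm_tail_le _ _).trans ?_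
            rw [hnorm, pow_add]
        _ = _ := by ring
    have h3 : ‖b.tail (L (J + 1)) ((1 / 4 : ℂ) ^ (J + 1) • u (L (J + 1)))‖
        = (1 / 4) ^ (J + 1) := by
      rw [b.tail_eq_self, hnorm]
      intro i hi
      rw [map_smul, hu0 _ i hi, smul_zero]
    have h4 : ‖b.tail (L (J + 1)) ((1 / 4 : ℂ) ^ (J + 1) • u (L (J + 1)))‖ ≤
        ‖b.tail (L (J + 1)) x‖ + ‖S₁‖ + ‖S₂‖ := by
      rw [← e2]
      have := norm_sub_le (S₁ + b.tail (L (J + 1)) ((1 / 4 : ℂ) ^ (J + 1) • u (L (J + 1))) + S₂ - S₁) S₂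
      have h5 := norm_sub_le (S₁ + b.tail (L (J + 1)) ((1 / 4 : ℂ) ^ (J + 1) • u (L (J + 1))) + S₂) S₁
      rw [show S₁ + b.tail (L (J + 1)) ((1 / 4 : ℂ) ^ (J + 1) • u (L (J + 1))) + S₂ - S₁ - S₂ =
        b.tail (L (J + 1)) ((1 / 4 : ℂ) ^ (J + 1) • u (L (J + 1))) by abel] at this
      linarith
    have h5 : (0 : ℝ) < (1 / 4) ^ (J + 1) := by positivity
    rw [pow_succ]
    linarith
  refine ⟨x, ?_, ?_, ?_⟩
  · exact hMc.mem_of_tendsto hsum.hasSum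
      (Eventually.of_forall fun s => M.sum_mem fun i _ => M.smul_mem _ (huM _))
  · intro h0
    have := hlow 0
    rw [h0, map_zero, norm_zero] at this
    norm_num at this
  · filter_upwards [eventually_ge_atTop (L 1)] with N hN
    -- Between consecutive values of L, tail norms decrease in N, so the bound at the right end
    -- serves the whole interval.
    have hind : ∀ k N, L 1 ≤ N → N ≤ L (k + 1) → ε N ≤ ‖b.tail N x‖ := by
      intro k
      induction k with
      | zero =>
        intro N h1 h2
        obtain rfl : N = L 1 := le_antisymm h2 h1
        refine (hF3 0 (L 0) _ le_rfl).trans (le_trans ?_ (hlow 0))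
        norm_num
      | succ k ih =>
        intro N h1 h2
        rcases le_total N (L (k + 1)) with h | h
        · exact ih N h1 h
        · exact (hF3 k (L k) N h).trans ((hlow (k + 1)).trans (b.norm_tail_le_tail h2 x))
    exact hind N N hN ((Nat.le_succ N).trans (hmono.le_apply))

theorem mul_norm_tail_le_norm_pow
    (hB : ∀ i x, b.coord i (B x) = w (i + 2) * b.coord (i + 1) x) {n : ℕ} {c : ℝ} (hc : 0 ≤ c)
    (h : ∀ i, c ≤ shiftProd w n i) (x : X) : c * ‖b.tail n x‖ ≤ ‖(B ^ n) x‖ := by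
  have : ‖(c : ℂ) • b.tail n x‖ ≤ ‖(B ^ n) x‖ := by
    refine b.norm_le_of_shift n 0 _ _ (fun i hi => by simp [b.coord_tail, hi]) fun i => ?_
    rw [map_smul, b.coord_tail, if_neg (by omega), norm_smul, Complex.norm_real,
      Real.norm_of_nonneg hc, add_zero, b.norm_coord_pow hB]
    exact mul_le_mul_of_nonneg_right (h i) (norm_nonneg _)
  rwa [norm_smul, Complex.norm_real, Real.norm_of_nonneg hc] at this

/-- Without isolated points, a dense orbit stays dense after deleting finitely many terms, so it
would enter the unit ball at a late time. -/
theorem not_isHypercyclicVector_of_eventually_one_le {x : X} (hx0 : x ≠ 0)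
    (hx : ∀ᶠ n in atTop, 1 ≤ ‖(B ^ n) x‖) : ¬ IsHypercyclicVector B x := by
  intro hd
  have : Nontrivial X := ⟨x, 0, hx0⟩
  have : ∀ y : X, (𝓝[≠] y).NeBot := fun y => Module.punctured_nhds_neBot ℂ X y
  obtain ⟨N, hN⟩ := eventually_atTop.1 hx
  have hd' := hd.sdiff_finite ((Set.finite_lt_nat N).image fun n => (B ^ n) x)
  obtain ⟨y, ⟨⟨n, -, rfl⟩, hn⟩, hy⟩ := hd'.exists_dist_lt 0 one_pos
  rw [dist_zero_left] at hy
  refine absurd (hN n ?_) (not_le.2 hy)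
  by_contra! hlt
  exact hn ⟨n, hlt, rfl⟩

theorem supInfProd_le_one_of_hasHypercyclicSubspace [CompleteSpace X]
    (hB : ∀ i x, b.coord i (B x) = w (i + 2) * b.coord (i + 1) x)
    (hyp : HasHypercyclicSubspace B) : supInfProd w ≤ 1 := by
  by_contra hw
  obtain ⟨n, hn, c, hc, h⟩ := exists_le_shiftProd_of_not_supInfProd_le_one hw
  obtain ⟨C, hC, hCle⟩ := exists_tendsto_le_shiftProd (le_max_left 1 ‖B‖)
    (fun i => (b.norm_weight_le hB i).trans (le_max_right _ _)) hn hc h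
  obtain ⟨M, hMc, hM, hMh⟩ := hyp
  obtain ⟨x, hxM, hx0, hx⟩ := b.exists_slowly_decaying_tail hMc hM hC.inv_tendsto_atTop
  refine not_isHypercyclicVector_of_eventually_one_le hx0 ?_ (hMh x hxM hx0)
  filter_upwards [hx, hC.eventually_gt_atTop 0] with N hN hpos
  refine le_trans ?_ (b.mul_norm_tail_le_norm_pow hB hpos.le (hCle N) x)
  simpa [hpos.ne'] using mul_le_mul_of_nonneg_left hN hpos.le

end ShiftBasis

/-! ### Sufficiency: perturbing a coordinate subspace -/

namespace ShiftBasis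

variable {X : Type*} [NormedAddCommGroup X] [NormedSpace ℂ X] (b : ShiftBasis X)
  {w : ℕ → ℂ} {B : X →L[ℂ] X}

/-- Interlaced times `T` and positions `r`, with small vectors `z t` that are mapped to
truncations of `y t` at time `T (t + 1)`, such that the orbits of the basis vectors at the later
positions stay bounded up to each time. -/
theorem exists_interlaced_sequences (hw : ∀ n : ℕ, 1 ≤ n → w n ≠ 0)
    (hB : ∀ i x, b.coord i (B x) = w (i + 2) * b.coord (i + 1) x) (hyp : IsHypercyclic B)
    {W : ℝ} (hW1 : 1 ≤ W) (hW : ∀ i, ‖w (i + 2)‖ ≤ W)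
    {C : ℝ} (hC : ∀ n, 1 ≤ n → ∃ i, shiftProd w n i ≤ C) (y : ℕ → X) :
    ∃ (T r : ℕ → ℕ) (z : ℕ → X), (∀ t, T t < r t) ∧ (∀ t, r t < T (t + 1)) ∧
      (∀ t, T t + t ≤ T (t + 1)) ∧ (∀ t, ∀ j ≤ T t, shiftProd w j (r t - j) ≤ 2) ∧
      (∀ t, ‖z t‖ * W ^ T t ≤ 1 / 4 * (1 / 2) ^ t) ∧
      (∀ t, (B ^ T (t + 1)) (z t) = y t - b.tail t (y t)) ∧
      ∀ t n, T (t + 1) + t ≤ n → (B ^ n) (z t) = 0 := by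
  have step : ∀ t M : ℕ, ∃ q : ℕ × ℕ × X, M < q.1 ∧ q.1 < q.2.1 ∧ M + t ≤ q.2.1 ∧
      (∀ j ≤ M, shiftProd w j (q.1 - j) ≤ 2) ∧ ‖q.2.2‖ * W ^ M ≤ 1 / 4 * (1 / 2) ^ t ∧
      (B ^ q.2.1) q.2.2 = y t - b.tail t (y t) ∧ ∀ n, q.2.1 + t ≤ n → (B ^ n) q.2.2 = 0 := by
    intro t M
    obtain ⟨i, hi, hi2⟩ := exists_shiftProd_le_two hw hW1 hW hC M 1
    have hWM : 0 < W ^ M := by positivity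
    -- Dividing the tolerance by W^M keeps B^n z small for all n up to the current time M.
    obtain ⟨N, hN, z, hz, hz1, hz2⟩ := b.exists_small_preimage hw hB hyp (y t)
      (ε := 1 / 4 * (1 / 2) ^ t / W ^ M) (by positivity) t (i + M + t + 1)
    refine ⟨(i + M, N, z), ?_, ?_, ?_, hi2, (le_div_iff₀ hWM).1 hz, hz1, hz2⟩ <;> simp only <;>
      omega
  choose q hq using step
  let T : ℕ → ℕ := fun n => Nat.rec 0 (fun t M => (q t M).2.1) n
  exact ⟨T, fun t => (q t (T t)).1, fun t => (q t (T t)).2.2, fun t => (hq t (T t)).1,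
    fun t => (hq t (T t)).2.1, fun t => (hq t (T t)).2.2.1, fun t => (hq t (T t)).2.2.2.1,
    fun t => (hq t (T t)).2.2.2.2.1, fun t => (hq t (T t)).2.2.2.2.2.1,
    fun t => (hq t (T t)).2.2.2.2.2.2⟩

/-- The vectors whose coordinates vanish outside `s`. -/
def supportedOn (s : Set ℕ) : Submodule ℂ X := ⨅ k ∈ sᶜ, LinearMap.ker (b.coord k)

theorem mem_supportedOn {s : Set ℕ} {x : X} :
    x ∈ b.supportedOn s ↔ ∀ k, k ∉ s → b.coord k x = 0 := by
  simp [supportedOn, Submodule.mem_iInf]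

theorem isClosed_supportedOn (s : Set ℕ) : IsClosed (b.supportedOn s : Set X) := by
  have : (b.supportedOn s : Set X) = ⋂ k ∈ sᶜ, {x | b.coordL k x = 0} := by
    ext x
    simp [mem_supportedOn]
  rw [this]
  exact isClosed_biInter fun k _ => isClosed_eq (b.coordL k).continuous continuous_const

theorem not_finiteDimensional_supportedOn {r : ℕ → ℕ} (hr : Function.Injective r) :
    ¬ FiniteDimensional ℂ (b.supportedOn (Set.range r)) := by
  intro hfin
  let v : ℕ → b.supportedOn (Set.range r) := fun t => ⟨b.single (r t), by
    rw [mem_supportedOn]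
    intro k hk
    rw [b.coord_single, if_neg]
    rintro rfl
    exact hk ⟨t, rfl⟩⟩
  have hv : LinearIndependent ℂ v := by
    rw [linearIndependent_iff']
    intro s g hg i hi
    have h := congrArg (fun x : b.supportedOn (Set.range r) => b.coord (r i) x) hg
    simpa [v, b.coord_single, hr.eq_iff, hi] using h
  have := hv.lt_aleph0_of_finiteDimensional
  simp at this

/-- The image of a closed infinite-dimensional subspace under a perturbation of the identity of
norm at most `1 / 2` is closed and infinite-dimensional. -/
theorem _root_.Submodule.isClosed_map_id_add [CompleteSpace X] {M : Submodule ℂ X}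
    (hMc : IsClosed (M : Set X)) (hM : ¬ FiniteDimensional ℂ M) {K : X →L[ℂ] X}
    (hK : ‖K‖ ≤ 1 / 2) :
    IsClosed (M.map (ContinuousLinearMap.id ℂ X + K).toLinearMap : Set X) ∧
      ¬ FiniteDimensional ℂ (M.map (ContinuousLinearMap.id ℂ X + K).toLinearMap) := by
  have hanti : AntilipschitzWith 2 (ContinuousLinearMap.id ℂ X + K) := by
    refine AddMonoidHomClass.antilipschitz_of_bound _ fun x => ?_
    have h1 : ‖K x‖ ≤ 1 / 2 * ‖x‖ := K.le_of_opNorm_le hK x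
    have h2 := norm_sub_le (x + K x) (K x)
    rw [add_sub_cancel_right] at h2
    simp only [NNReal.coe_ofNat, add_apply, ContinuousLinearMap.id_apply]
    linarith
  refine ⟨?_, fun hfin => hM ?_⟩
  · exact (hanti.isClosedEmbedding
      (ContinuousLinearMap.id ℂ X + K).uniformContinuous).isClosedMap _ hMc
  · exact LinearEquiv.finiteDimensional
      (Submodule.equivMapOfInjective (ContinuousLinearMap.id ℂ X + K).toLinearMap
        hanti.injective M).symm

theorem exists_hasSum_smul [CompleteSpace X] {φ : ℕ → X →L[ℂ] ℂ} {z : ℕ → X} {g : ℕ → ℝ} {a : ℝ}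
    (hφ : ∀ t, ‖φ t‖ ≤ 1) (hz : ∀ t, ‖z t‖ ≤ g t) (hg : HasSum g a) :
    ∃ K : X →L[ℂ] X, ‖K‖ ≤ a ∧ ∀ x, HasSum (fun t => φ t x • z t) (K x) := by
  have hk : ∀ t, ‖(φ t).smulRight (z t)‖ ≤ g t := fun t => by
    rw [ContinuousLinearMap.norm_smulRight_apply]
    exact (mul_le_of_le_one_left (norm_nonneg _) (hφ t)).trans (hz t)
  obtain ⟨K, hK⟩ := Summable.of_norm_bounded hg.summable hk
  refine ⟨K, hK.norm_le_of_bounded hg hk, fun x => ?_⟩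
  have := hK.map (ContinuousLinearMap.apply ℂ X x) (ContinuousLinearMap.apply ℂ X x).continuous
  simpa [Function.comp_def] using this

theorem norm_pow_apply_le {W : ℝ} (hW : ‖B‖ ≤ W) (n : ℕ) (x : X) :
    ‖(B ^ n) x‖ ≤ W ^ n * ‖x‖ := by
  induction n with
  | zero => simp
  | succ n ih =>
    rw [pow_succ', mul_apply_eq_comp, pow_succ', mul_assoc]
    exact (B.le_of_opNorm_le hW _).trans
      (mul_le_mul_of_nonneg_left ih ((norm_nonneg B).trans hW))

theorem norm_pow_apply_le_two_mul_tail
    (hB : ∀ i x, b.coord i (B x) = w (i + 2) * b.coord (i + 1) x) {n : ℕ} {x : X}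
    (h : ∀ k, b.coord (k + n) x ≠ 0 → shiftProd w n k ≤ 2) :
    ‖(B ^ n) x‖ ≤ 2 * ‖b.tail n x‖ := by
  have : ‖(B ^ n) x‖ ≤ ‖(2 : ℂ) • b.tail n x‖ := by
    refine b.norm_le_of_shift 0 n _ _ (by simp) fun i => ?_
    rw [map_smul, b.coord_tail, if_neg (by omega), norm_smul, add_zero, b.norm_coord_pow hB,
      Complex.norm_ofNat]
    by_cases h0 : b.coord (i + n) x = 0
    · simp [h0]
    · exact mul_le_mul_of_nonneg_right (h i h0) (norm_nonneg _)
  simpa [norm_smul] using this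

theorem hasHypercyclicSubspace_of_supInfProd_lt_top [CompleteSpace X]
    (hw : ∀ n : ℕ, 1 ≤ n → w n ≠ 0)
    (hB : ∀ i x, b.coord i (B x) = w (i + 2) * b.coord (i + 1) x) (hyp : IsHypercyclic B)
    (hfin : supInfProd w < ∞) : HasHypercyclicSubspace B := by
  obtain ⟨C, hC⟩ := exists_shiftProd_le_of_supInfProd_lt_top hfin
  set W : ℝ := max 1 ‖B‖
  have hW1 : 1 ≤ W := le_max_left _ _
  have hBW : ‖B‖ ≤ W := le_max_right _ _
  obtain ⟨x₀, hx₀⟩ := id hyp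
  -- Each pair (coordinate, orbit index) must recur at arbitrarily late t, when the error terms are
  -- small.
  obtain ⟨ι, σ, hισ⟩ : ∃ ι σ : ℕ → ℕ, ∀ i s t₀ : ℕ, ∃ t, t₀ ≤ t ∧ ι t = i ∧ σ t = s :=
    ⟨fun t => t.unpair.1, fun t => t.unpair.2.unpair.1, fun i s t₀ =>
      ⟨Nat.pair i (Nat.pair s t₀), (Nat.right_le_pair s t₀).trans (Nat.right_le_pair i _),
        by simp, by simp⟩⟩
  obtain ⟨T, r, z, hTr, hrT, hTt, hr2, hzW, hzy, hz0⟩ := b.exists_interlaced_sequences hw hB hyp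
    hW1 (fun i => (b.norm_weight_le hB i).trans hBW) hC fun t => (B ^ σ t) x₀
  have hTmono : StrictMono T := strictMono_nat_of_lt_succ fun t => (hTr t).trans (hrT t)
  have hrmono : StrictMono r := strictMono_nat_of_lt_succ fun t => (hrT t).trans (hTr _)
  have hz : ∀ t, ‖z t‖ ≤ 1 / 4 * (1 / 2) ^ t := fun t =>
    (le_mul_of_one_le_right (norm_nonneg _) (one_le_pow₀ hW1)).trans (hzW t)
  have hgeo : HasSum (fun t : ℕ => 1 / 4 * (1 / 2 : ℝ) ^ t) (1 / 2) := by
    have h := hasSum_geometric_two.mul_left (1 / 4 : ℝ)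
    norm_num at h ⊢
    exact h
  obtain ⟨K, hK, hKx⟩ := exists_hasSum_smul (fun t => b.norm_coordL_le (r (ι t))) hz hgeo
  simp only [coordL_apply] at hKx
  obtain ⟨hcl, hinf⟩ := Submodule.isClosed_map_id_add (b.isClosed_supportedOn (Set.range r))
    (b.not_finiteDimensional_supportedOn hrmono.injective) hK
  refine ⟨_, hcl, hinf, ?_⟩
  rintro - ⟨x, hx, rfl⟩ hne
  change x + K x ≠ 0 at hne
  change IsHypercyclicVector B (x + K x)
  rw [SetLike.mem_coe, mem_supportedOn] at hx

  -- A position r s that survives T (t + 1) steps has s > t, and its window products up to T s are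
  -- at most 2.
  have hBx : ∀ t, ‖(B ^ T (t + 1)) x‖ ≤ 2 * ‖b.tail (T (t + 1)) x‖ := by
    refine fun t => b.norm_pow_apply_le_two_mul_tail hB fun j hj => ?_
    obtain ⟨s, hs⟩ : j + T (t + 1) ∈ Set.range r := by
      by_contra h
      exact hj (hx _ h)
    have hts : t < s := by
      by_contra! h
      have := hrmono.monotone h
      have := hrT t
      omega
    have := hr2 s (T (t + 1)) (hTmono.monotone hts)
    rwa [hs, Nat.add_sub_cancel] at this
  -- At time T (t + 1) the vectors z s with s < t are already annihilated; those with s > t are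
  -- still small, by the factor W^(T s) in `hzW`.
  have hBK : ∀ t, ‖(B ^ T (t + 1)) (K x) - b.coord (r (ι t)) x • (B ^ T (t + 1)) (z t)‖ ≤
      ‖x‖ * (1 / 2) ^ t := by
    intro t
    have hs := (B ^ T (t + 1)).hasSum (hKx x)
    simp only [map_smul] at hs
    have e := hs.summable.sum_add_tsum_nat_add (t + 1)
    rw [hs.tsum_eq, Finset.sum_range_succ, Finset.sum_eq_zero, zero_add] at e
    · rw [← e, add_sub_cancel_left]
      have hgeo' : HasSum (fun m : ℕ => ‖x‖ * (1 / 4 * (1 / 2 : ℝ) ^ m) * (1 / 2) ^ (t + 1))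
          (‖x‖ * (1 / 2) * (1 / 2) ^ (t + 1)) := (hgeo.mul_left _).mul_right _
      refine (tsum_of_norm_bounded hgeo' fun m => ?_).trans ?_
      · rw [norm_smul, mul_assoc ‖x‖]
        refine mul_le_mul (b.norm_coord_le _ _) ?_ (norm_nonneg _) (norm_nonneg _)
        refine (norm_pow_apply_le hBW _ _).trans ?_
        rw [mul_comm]
        refine (mul_le_mul_of_nonneg_left (pow_le_pow_right₀ hW1
          (hTmono.monotone (by omega : t + 1 ≤ m + (t + 1)))) (norm_nonneg _)).trans ?_
        refine (hzW _).trans (le_of_eq ?_)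
        rw [pow_add]
        ring
      · rw [pow_succ]
        have : 0 ≤ ‖x‖ * (1 / 2 : ℝ) ^ t := by positivity
        linarith
    · intro s hs
      rw [hz0 s, smul_zero]
      have h1 : T (s + 1) ≤ T t := hTmono.monotone (Finset.mem_range.1 hs)
      have h2 := hTt t
      have := Finset.mem_range.1 hs
      omega
  obtain ⟨i, hi⟩ : ∃ i, b.coord (r i) x ≠ 0 := by
    by_contra! h
    refine hne ?_
    have : x = 0 := b.eq_zero_of_coord fun j => by
      by_cases hj : j ∈ Set.range r
      · obtain ⟨t, rfl⟩ := hj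
        exact h t
      · exact hx j hj
    simp [this]
  set a := b.coord (r i) x
  have ha : 0 < ‖a‖ := norm_pos_iff.2 hi
  refine Metric.dense_iff.2 fun u ε hε => ?_
  -- Approximating a⁻¹u makes a B^s x₀ close to u. The four quarters of ε pay for this, B^T x, the
  -- rest of B^T K x, and the truncation of B^s x₀.
  obtain ⟨-, ⟨s, -, rfl⟩, hs⟩ := hx₀.exists_dist_lt (a⁻¹ • u) (ε := ε / 4 / ‖a‖) (by positivity)
  have hT1 : Tendsto (fun t => T (t + 1)) atTop atTop :=
    hTmono.tendsto_atTop.comp (tendsto_add_atTop_nat 1)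
  have l1 : Tendsto (fun t => 2 * ‖b.tail (T (t + 1)) x‖) atTop (𝓝 0) := by
    simpa using (((b.tendsto_tail x).comp hT1).norm).const_mul 2
  have l2 : Tendsto (fun t => ‖a‖ * ‖b.tail t ((B ^ s) x₀)‖) atTop (𝓝 0) := by
    simpa using ((b.tendsto_tail ((B ^ s) x₀)).norm).const_mul ‖a‖
  have l3 : Tendsto (fun t : ℕ => ‖x‖ * (1 / 2 : ℝ) ^ t) atTop (𝓝 0) := by
    simpa using (tendsto_pow_atTop_nhds_zero_of_lt_one (r := (1 / 2 : ℝ)) (by norm_num)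
      (by norm_num)).const_mul ‖x‖
  have hε4 : 0 < ε / 4 := by positivity
  obtain ⟨t₀, ht₀⟩ := eventually_atTop.1 ((l1.eventually_lt_const hε4).and
    ((l2.eventually_lt_const hε4).and (l3.eventually_lt_const hε4)))
  obtain ⟨t, ht, hit, hst⟩ := hισ i s t₀
  obtain ⟨h1, h2, h3⟩ := ht₀ t ht
  refine ⟨(B ^ T (t + 1)) (x + K x), ?_, T (t + 1), (Nat.zero_le _).trans_lt (hrT t), rfl⟩
  have h4 := hBK t
  rw [hzy, hit, hst] at h4
  rw [dist_eq_norm] at hs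
  have h5 : ‖u - a • (B ^ s) x₀‖ < ε / 4 := by
    have : u - a • (B ^ s) x₀ = a • (a⁻¹ • u - (B ^ s) x₀) := by
      rw [smul_sub, smul_inv_smul₀ hi]
    rw [this, norm_smul, mul_comm]
    exact (lt_div_iff₀ ha).1 hs
  rw [Metric.mem_ball, dist_eq_norm, map_add]
  have e : (B ^ T (t + 1)) x + (B ^ T (t + 1)) (K x) - u =
      (B ^ T (t + 1)) x +
      ((B ^ T (t + 1)) (K x) - a • ((B ^ s) x₀ - b.tail t ((B ^ s) x₀))) -
      a • b.tail t ((B ^ s) x₀) - (u - a • (B ^ s) x₀) := by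
    rw [smul_sub]; abel
  rw [e]
  have n1 := norm_sub_le ((B ^ T (t + 1)) x +
      ((B ^ T (t + 1)) (K x) - a • ((B ^ s) x₀ - b.tail t ((B ^ s) x₀))) -
      a • b.tail t ((B ^ s) x₀)) (u - a • (B ^ s) x₀)
  have n2 := norm_sub_le ((B ^ T (t + 1)) x +
      ((B ^ T (t + 1)) (K x) - a • ((B ^ s) x₀ - b.tail t ((B ^ s) x₀))))
      (a • b.tail t ((B ^ s) x₀))
  have n3 := norm_add_le ((B ^ T (t + 1)) x)
      ((B ^ T (t + 1)) (K x) - a • ((B ^ s) x₀ - b.tail t ((B ^ s) x₀)))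
  rw [norm_smul] at n2
  have := hBx t
  linarith

theorem hasHypercyclicSubspace_iff [CompleteSpace X] {e : ℕ → X} (he0 : e 0 = 0)
    (he : ∀ i, e (i + 1) = b.single i) (hw : ∀ n : ℕ, 1 ≤ n → w n ≠ 0)
    (hshift : IsWeightedShift e w B) (hyp : IsHypercyclic B) :
    (HasHypercyclicSubspace B ↔ supInfProd w ≤ 1) ∧
      (HasHypercyclicSubspace B ↔ supInfProd w < ∞) := by
  have hB := b.coord_shift_of_single (B := B) (w := w)
    (by rw [← he, hshift _ le_rfl, Nat.sub_self, he0, smul_zero])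
    (fun i => by rw [← he, ← he, hshift _ (by omega)]; rfl)
  have h1 : HasHypercyclicSubspace B → supInfProd w ≤ 1 :=
    b.supInfProd_le_one_of_hasHypercyclicSubspace hB
  have h2 : supInfProd w < ∞ → HasHypercyclicSubspace B :=
    b.hasHypercyclicSubspace_of_supInfProd_lt_top hw hB hyp
  exact ⟨⟨h1, fun h => h2 (h.trans_lt ENNReal.one_lt_top)⟩,
    ⟨fun h => (h1 h).trans_lt ENNReal.one_lt_top, h2⟩⟩

end ShiftBasis

/-! ### The canonical bases of ℓ^p and c_0 -/

theorem lp.norm_le_of_shift {p : ℝ≥0∞} (hp : 0 < p.toReal) {m n : ℕ}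
    {x y : lp (fun _ : ℕ => ℂ) p} (h0 : ∀ i < m, x i = 0)
    (h : ∀ i, ‖x (i + m)‖ ≤ ‖y (i + n)‖) : ‖x‖ ≤ ‖y‖ := by
  have hx := (lp.memℓp x).summable hp
  have hy := (lp.memℓp y).summable hp
  rw [lp.norm_eq_tsum_rpow hp, lp.norm_eq_tsum_rpow hp]
  refine Real.rpow_le_rpow (tsum_nonneg fun _ => by positivity) ?_ (by positivity)
  rw [← hx.sum_add_tsum_nat_add m, Finset.sum_eq_zero, zero_add]
  · refine (Summable.tsum_le_tsum
      (fun i => Real.rpow_le_rpow (norm_nonneg _) (h i) hp.le)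
      ((summable_nat_add_iff m).2 hx) ((summable_nat_add_iff n).2 hy)).trans ?_
    rw [← hy.sum_add_tsum_nat_add n]
    exact le_add_of_nonneg_left (Finset.sum_nonneg fun _ _ => by positivity)
  · intro i hi
    simp [h0 i (Finset.mem_range.1 hi), Real.zero_rpow hp.ne']

/-- The canonical basis of `ℓ^p` for `p < ∞`. -/
noncomputable def lpShiftBasis (p : ℝ≥0∞) [Fact (1 ≤ p)] (hp : p ≠ ∞) :
    ShiftBasis (lp (fun _ : ℕ => ℂ) p) where
  coord i :=
    { toFun := fun x => x i
      map_add' := fun _ _ => rfl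
      map_smul' := fun _ _ => rfl }
  single i := lp.single p i 1
  coord_single i j := by
    change (lp.single (E := fun _ : ℕ => ℂ) p j 1) i = _
    rw [lp.single_apply, Pi.single_apply]
  norm_single i := by
    rw [lp.norm_single (E := fun _ : ℕ => ℂ) (zero_lt_one.trans_le (Fact.out : 1 ≤ p)), norm_one]
  norm_le_of_shift _ _ _ _ h0 h := lp.norm_le_of_shift
    (ENNReal.toReal_pos (zero_lt_one.trans_le (Fact.out : 1 ≤ p)).ne' hp) h0 h
  tendsto_sum x := by
    have h := (lp.hasSum_single hp x).tendsto_sum_nat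
    refine h.congr fun n => Finset.sum_congr rfl fun i _ => ?_
    change _ = x i • lp.single (E := fun _ : ℕ => ℂ) p i 1
    rw [← lp.single_smul, smul_eq_mul, mul_one]

namespace ZeroAtInftyContinuousMap

theorem norm_apply_le (f : C₀(ℕ, ℂ)) (i : ℕ) : ‖f i‖ ≤ ‖f‖ := f.toBCF.norm_coe_le_norm i

theorem norm_le_of_forall {f : C₀(ℕ, ℂ)} {c : ℝ} (hc : 0 ≤ c) (h : ∀ i, ‖f i‖ ≤ c) : ‖f‖ ≤ c :=
  (BoundedContinuousFunction.norm_le hc).2 h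

end ZeroAtInftyContinuousMap

theorem c0Single_apply (i j : ℕ) : c0Single i j = if j = i then 1 else 0 := by
  change (Pi.single i 1 : ℕ → ℂ) j = _
  rw [Pi.single_apply]

/-- The canonical basis of `c_0`. -/
noncomputable def c0ShiftBasis : ShiftBasis C₀(ℕ, ℂ) where
  coord i :=
    { toFun := fun x => x i
      map_add' := fun _ _ => rfl
      map_smul' := fun _ _ => rfl }
  single := c0Single
  coord_single i j := c0Single_apply j i
  norm_single i := by
    refine le_antisymm
      (ZeroAtInftyContinuousMap.norm_le_of_forall zero_le_one fun j => ?_) ?_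
    · rw [c0Single_apply]
      split_ifs <;> simp
    · simpa [c0Single_apply] using (c0Single i).norm_apply_le i
  norm_le_of_shift m n x y h0 h := by
    refine ZeroAtInftyContinuousMap.norm_le_of_forall (norm_nonneg y) fun i => ?_
    rcases lt_or_ge i m with hi | hi
    · have : x i = 0 := h0 i hi
      simp [this]
    · obtain ⟨i, rfl⟩ := Nat.exists_eq_add_of_le' hi
      exact (h i).trans (y.norm_apply_le _)
  tendsto_sum x := by
    refine Metric.tendsto_atTop.2 fun ε hε => ?_
    have hx : Tendsto x atTop (𝓝 0) := by
      have := x.zero_at_infty'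
      rwa [cocompact_eq_cofinite, Nat.cofinite_eq_atTop] at this
    obtain ⟨N, hN⟩ := Metric.tendsto_atTop.1 hx (ε / 2) (by positivity)
    refine ⟨N, fun n hn => ?_⟩
    rw [dist_eq_norm]
    refine lt_of_le_of_lt (ZeroAtInftyContinuousMap.norm_le_of_forall (half_pos hε).le
      fun i => ?_) (half_lt_self hε)
    let ev : C₀(ℕ, ℂ) →+ ℂ :=
      { toFun := fun f => f i
        map_zero' := rfl
        map_add' := fun _ _ => rfl }
    have e : (∑ j ∈ Finset.range n, x j • c0Single j : C₀(ℕ, ℂ)) i =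
        if i < n then x i else 0 := by
      change ev _ = _
      rw [map_sum]
      change ∑ j ∈ Finset.range n, x j * c0Single j i = _
      simp [c0Single_apply]
    change ‖(∑ j ∈ Finset.range n, x j • c0Single j : C₀(ℕ, ℂ)) i - x i‖ ≤ _
    rw [e]
    split_ifs with hi
    · simpa using (half_pos hε).le
    · have := hN i (by omega)
      rw [dist_zero_right] at this
      simpa using this.le

theorem theorem3p3 (w : ℕ → ℂ) (hw : ∀ n : ℕ, 1 ≤ n → w n ≠ 0) :
    (∀ (p : ℝ≥0∞) [Fact (1 ≤ p)], p ≠ ∞ →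
      ∀ B : lp (fun _ : ℕ => ℂ) p →L[ℂ] lp (fun _ : ℕ => ℂ) p,
        IsWeightedShift (lpBasis p) w B → IsHypercyclic B →
          (HasHypercyclicSubspace B ↔ supInfProd w ≤ 1) ∧
          (HasHypercyclicSubspace B ↔ supInfProd w < ∞)) ∧
    (∀ B : C₀(ℕ, ℂ) →L[ℂ] C₀(ℕ, ℂ),
        IsWeightedShift c0Basis w B → IsHypercyclic B →
          (HasHypercyclicSubspace B ↔ supInfProd w ≤ 1) ∧
          (HasHypercyclicSubspace B ↔ supInfProd w < ∞)) :=
  ⟨fun p _ hp _ hB hyp =>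
    (lpShiftBasis p hp).hasHypercyclicSubspace_iff rfl (fun _ => rfl) hw hB hyp,
    fun _ hB hyp => c0ShiftBasis.hasHypercyclicSubspace_iff rfl (fun _ => rfl) hw hB hyp⟩
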